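/- Let $X_1,X_2,\dots$ and $\varepsilon_1,\varepsilon_2,\dots$ be independent real random variables, the $\varepsilon_i$ with known Lebesgue density $h$ such that $E\varepsilon_i=0$ and $0<E\varepsilon_i^2<\infty$, and observe $Y_i=X_i+\varepsilon_i$. Let $f_0$ be a known probability density and let $H_0$ be the hypothesis that every $X_i$ has density $f_0$. Fix $d\ge 1$. For every $k=1,\dots,d$ let $\{f^{(k)}_\theta:\theta\in\Theta_k\}$ be a family of probability densities on $\mathbb{R}$, where $\Theta_k\subseteq\mathbb{R}^k$ is open, $0\in\Theta_k$ and $f^{(k)}_0=f_0$ almost everywhere (this includes nested families of submodels $\Theta_1\subset\Theta_2\subset\dots\subset\Theta_d$). Put $$q_k(y;\theta)=\int_{\mathbb{R}} f^{(k)}_\theta(s)\,h(y-s)\,ds,\qquad dQ_{k,\theta}=q_k(\cdot\,;\theta)\,d\lambda,$$ $$\dot l_k(y;\theta)=\frac{\nabla_\theta\, q_k(y;\theta)}{q_k(y;\theta)}\,1_{[q_k(y;\theta)>0]},\qquad I_k(\theta)=\int_{\mathbb{R}}\dot l_k(y;\theta)\,\dot l_k(y;\theta)^T\,dQ_{k,\theta}(y),$$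 where $\lambda$ is Lebesgue measure. Assume that for every $k=1,\dots,d$: (B1) for $\lambda$-almost every $y$, the function $\theta\mapsto q_k(y;\theta)$ is continuously differentiable on $\Theta_k$; (B2) $|\dot l_k(\cdot\,;\theta)|\in L_2(\mathbb{R},Q_{k,\theta})$ for all $\theta\in\Theta_k$; (B3) $I_k(\theta)$ is nonsingular for all $\theta\in\Theta_k$ and continuous in $\theta$ on $\Theta_k$. For a sample of size $n$ let $$U_k=\Bigl\{\frac1{\sqrt n}\sum_{j=1}^n \dot l_k(Y_j;0)\Bigr\}^{T} I_k(0)^{-1}\Bigl\{\frac1{\sqrt n}\sum_{j=1}^n \dot l_k(Y_j;0)\Bigr\}.$$ Let $\pi(j,n)$ be real numbers such that $\pi(1,n)<\pi(2,n)<\dots<\pi(d,n)$ for all $n\ge1$ and $\pi(j,n)-\pi(1,n)\to\infty$ as $n\to\infty$ for every $j=2,\dots,d$, and let $$S=\min\bigl\{k:\ 1\le k\le d,\ U_k-\pi(k,n)\ge U_j-\pi(j,n)\ \text{ for all } j=1,\dots,d\bigr\}.$$ Then, under $H_0$, as $n\to\infty$, $$P_0(S>1)\to 0\qquad\text{and}\qquad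 U_S\to_d\chi^2_1 ,$$ where $\chi^2_1$ is the chi-square distribution with one degree of freedom. -/

import Mathlib

open MeasureTheory ProbabilityTheory Filter Topology
open scoped Matrix

noncomputable section

namespace ScoreDeconvolution

/-- A probability density on the real line with respect to Lebesgue measure. -/
structure IsDensity (g : ℝ → ℝ) : Prop where
  measurable : Measurable g
  nonneg : ∀ x, 0 ≤ g x
  integrable : Integrable g volume
  integral_eq_one : ∫ x, g x = 1

/-- The measure on the real line with Lebesgue density `g`. -/
def law (g : ℝ → ℝ) : Measure ℝ :=
  volume.withDensity fun x => ENNReal.ofReal (g x)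

/-- A noise density: a probability density with mean zero and finite positive variance. -/
structure IsNoiseDensity (h : ℝ → ℝ) : Prop extends IsDensity h where
  integrable_sq : Integrable (fun x => x ^ 2 * h x) volume
  mean_zero : ∫ x, x * h x = 0
  second_moment_pos : 0 < ∫ x, x ^ 2 * h x

section Model

variable {k : ℕ} (f : EuclideanSpace ℝ (Fin k) → ℝ → ℝ) (h : ℝ → ℝ)

/-- The density `q(y; θ) = ∫ f_θ(s) h(y - s) ds` of an observation `Y = X + ε`. -/
def obsDensity (θ : EuclideanSpace ℝ (Fin k)) (y : ℝ) : ℝ :=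
  ∫ s, f θ s * h (y - s)

/-- The distribution `Q_θ` of an observation. -/
def obsLaw (θ : EuclideanSpace ℝ (Fin k)) : Measure ℝ :=
  law (obsDensity f h θ)

open Classical in
/-- The score function: gradient of `q(y; θ)` in `θ`, divided by `q(y; θ)`, on `q(y; θ) > 0`,
and zero elsewhere. -/
def score (θ : EuclideanSpace ℝ (Fin k)) (y : ℝ) : EuclideanSpace ℝ (Fin k) :=
  if 0 < obsDensity f h θ y then
    (obsDensity f h θ y)⁻¹ • gradient (fun η => obsDensity f h η y) θ
  else 0

/-- The Fisher information matrix `I(θ)`, with entries the `Q_θ`-integrals of the products of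
the coordinates of the score. -/
def fisherInformation (θ : EuclideanSpace ℝ (Fin k)) : Matrix (Fin k) (Fin k) ℝ :=
  Matrix.of fun i j => ∫ y, score f h θ y i * score f h θ y j ∂(obsLaw f h θ)

/-- A regular deconvolution problem with parameter set `Θ`. -/
structure IsRegular (Θ : Set (EuclideanSpace ℝ (Fin k))) : Prop where
  /-- B1: for almost all `y`, the map `θ ↦ q(y; θ)` is continuously differentiable on `Θ`. -/
  contDiffOn : ∀ᵐ y ∂(volume : Measure ℝ), ContDiffOn ℝ 1 (fun θ => obsDensity f h θ y) Θ
  /-- B2: the score is square integrable. -/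
  memLp_score : ∀ θ ∈ Θ, MemLp (score f h θ) 2 (obsLaw f h θ)
  /-- B3: the Fisher information is nonsingular on `Θ`. -/
  nonsingular : ∀ θ ∈ Θ, IsUnit (fisherInformation f h θ).det
  /-- B3: the Fisher information is continuous on `Θ`. -/
  continuousOn : ContinuousOn (fisherInformation f h) Θ

/-- The normalized sum `n^{-1/2} ∑_{j ≤ n} l*(y_j)` of the scores at `θ = 0`; the observations
`y_1, …, y_n` are `y 0, …, y (n - 1)`. -/
def normalizedScore (n : ℕ) (y : ℕ → ℝ) : Fin k → ℝ :=
  fun i => (Real.sqrt n)⁻¹ * ∑ j ∈ Finset.range n, score f h 0 (y j) i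

/-- The score test statistic `U_k`: the quadratic form of `L = I(0)⁻¹` at the normalized sum. -/
def scoreStatistic (n : ℕ) (y : ℕ → ℝ) : ℝ :=
  normalizedScore f h n y ⬝ᵥ ((fisherInformation f h 0)⁻¹ *ᵥ normalizedScore f h n y)

end Model

/-- A penalty for the models `1, …, d`: strictly increasing in the model index for every sample
size `n ≥ 1`, with all differences `π(j, n) - π(1, n)`, `2 ≤ j ≤ d`, tending to infinity. -/
structure IsPenalty (d : ℕ) (pen : ℕ → ℕ → ℝ) : Prop where
  strictMono : ∀ n, 1 ≤ n → ∀ i j, 1 ≤ i → i < j → j ≤ d → pen i n < pen j n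
  tendsto_atTop : ∀ j, 2 ≤ j → j ≤ d → Tendsto (fun n => pen j n - pen 1 n) atTop atTop

/-- The indices `1 ≤ k ≤ d` at which the penalized statistic `u k - p k` is maximal. -/
def maximizers (d : ℕ) (u p : ℕ → ℝ) : Set ℕ :=
  {k | 1 ≤ k ∧ k ≤ d ∧ ∀ j, 1 ≤ j → j ≤ d → u j - p j ≤ u k - p k}

/-- The selected index: the smallest maximizer of the penalized statistic. -/
def selection (d : ℕ) (u p : ℕ → ℝ) : ℕ := sInf (maximizers d u p)

/-- For `d ≥ 1` there is a maximizer, so the infimum defining the selected index is a minimum. -/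
theorem selection_isLeast {d : ℕ} (hd : 1 ≤ d) (u p : ℕ → ℝ) :
    IsLeast (maximizers d u p) (selection d u p) := by
  have hne : (maximizers d u p).Nonempty := by
    obtain ⟨k, hk, hmax⟩ := Finset.exists_max_image (Finset.Icc 1 d) (fun j => u j - p j)
      ⟨1, Finset.mem_Icc.2 ⟨le_rfl, hd⟩⟩
    rw [Finset.mem_Icc] at hk
    exact ⟨k, hk.1, hk.2, fun j h1 h2 => hmax j (Finset.mem_Icc.2 ⟨h1, h2⟩)⟩
  exact ⟨Nat.sInf_mem hne, fun k hk => Nat.sInf_le hk⟩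

/-- The central chi-square distribution with `k` degrees of freedom: the law of the sum of the
squares of `k` independent standard normal variables. -/
def chiSquare (k : ℕ) : Measure ℝ :=
  (Measure.pi fun _ : Fin k => gaussianReal 0 1).map fun z => ∑ i, z i ^ 2

instance isProbabilityMeasure_chiSquare (k : ℕ) : IsProbabilityMeasure (chiSquare k) :=
  Measure.isProbabilityMeasure_map (Measurable.aemeasurable (by fun_prop))

/-- Under the null hypothesis: signals `X_i` with density `f₀` and noises `ε_i` with density `h`,
all of them independent (the pairs are independent, and within each pair too). -/
structure IsNullModel {Ω : Type*} [MeasurableSpace Ω] (P : Measure Ω) (f₀ h : ℝ → ℝ)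
    (X ε : ℕ → Ω → ℝ) : Prop where
  law_signal : ∀ i, HasLaw (X i) (law f₀) P
  law_noise : ∀ i, HasLaw (ε i) (law h) P
  indep_pairs : iIndepFun (fun i ω => (X i ω, ε i ω)) P
  indep_signal_noise : ∀ i, IndepFun (X i) (ε i) P

section DataDriven

variable (f : (k : ℕ) → EuclideanSpace ℝ (Fin k) → ℝ → ℝ) (h : ℝ → ℝ) (d : ℕ)
  (pen : ℕ → ℕ → ℝ)

/-- The selection rule `S` computed from the observations `y_1, …, y_n`. -/
def selectionRule (n : ℕ) (y : ℕ → ℝ) : ℕ :=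
  selection d (fun k => scoreStatistic (f k) h n y) (fun k => pen k n)

/-- The data-driven statistic `U_S`. -/
def dataDrivenStatistic (n : ℕ) (y : ℕ → ℝ) : ℝ :=
  scoreStatistic (f (selectionRule f h d pen n y)) h n y

end DataDriven

end ScoreDeconvolution

end

namespace ScoreDeconvolution

/-!
For a curve `t ↦ q_t` of densities that is continuously differentiable in `t`, with derivative
`D_t`, the squares `(q_t ± D_t) ^ 2 / q_t = q_t ± 2 * D_t + D_t ^ 2 / q_t` are nonnegative and lower
semicontinuous in `t`. By Fatou's lemma so are their integrals, and as `∫ q_t` is constant and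
`∫ D_t ^ 2 / q_t` continuous, `t ↦ ∫ D_t` is both lower and upper semicontinuous. This continuity,
with the bound `|D_t| ≤ q_t + D_t ^ 2 / q_t`, lets one differentiate `∫ q_t = 1` under the integral
sign: the score has mean zero.

Hence `U_k` has expectation `tr (I_k(0)⁻¹ I_k(0)) = k` for every sample size `n ≥ 1`. Since
`U_1 ≥ 0`, the rule selects `k ≥ 2` only if `U_k` exceeds a penalty gap that diverges, which by
Markov's inequality has vanishing probability. Off this event `U_S = U_1`, and by the central limit
theorem `U_1`, the square of a standardized sum, is asymptotically chi-square.
-/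

section LowerSemicontinuity

variable {α T : Type*} [MeasurableSpace α] {μ : Measure α}
  [TopologicalSpace T] {t₀ : T}

theorem lowerSemicontinuousAt_sq_div {N q : T → ℝ} (hq0 : ∀ t, 0 ≤ q t)
    (hN : ContinuousAt N t₀) (hq : ContinuousAt q t₀) :
    LowerSemicontinuousAt (fun t => N t ^ 2 / q t) t₀ := by
  rcases (hq0 t₀).eq_or_lt with h | h
  · intro a ha
    simp only [← h, div_zero] at ha
    exact Eventually.of_forall fun t => ha.trans_le (div_nonneg (sq_nonneg _) (hq0 t))
  · exact ((hN.pow 2).div hq h.ne').lowerSemicontinuousAt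

theorem lowerSemicontinuousAt_integral [FirstCountableTopology T] {u : T → α → ℝ}
    (hu0 : ∀ t y, 0 ≤ u t y) (hu : ∀ t, Integrable (u t) μ)
    (hlsc : ∀ᵐ y ∂μ, LowerSemicontinuousAt (fun t => u t y) t₀) :
    LowerSemicontinuousAt (fun t => ∫ y, u t y ∂μ) t₀ := by
  have hmin : Tendsto (fun t => ∫ y, min (u t y) (u t₀ y) ∂μ) (𝓝 t₀) (𝓝 (∫ y, u t₀ y ∂μ)) := by
    refine tendsto_integral_filter_of_dominated_convergence (u t₀)
      (Eventually.of_forall fun t => ((hu t).inf (hu t₀)).aestronglyMeasurable)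
      (Eventually.of_forall fun t => ae_of_all _ fun y => ?_) (hu t₀) ?_
    · rw [Real.norm_of_nonneg (le_min (hu0 t y) (hu0 t₀ y))]
      exact min_le_right _ _
    · filter_upwards [hlsc] with y hy
      refine tendsto_order.2 ⟨fun a ha => ?_, fun a ha => ?_⟩
      · filter_upwards [hy a ha] with t ht using lt_min ht ha
      · exact Eventually.of_forall fun t => (min_le_right _ _).trans_lt ha
  intro a ha
  filter_upwards [hmin.eventually_const_lt ha] with t ht
  exact ht.trans_le
    (integral_mono ((hu t).inf (hu t₀)) (hu t) fun y => min_le_left _ _)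

end LowerSemicontinuity

section Fisher

theorem add_sq_div_self {K : Type*} [Field K] {q D : K} (h : q = 0 → D = 0) :
    (q + D) ^ 2 / q = q + 2 * D + D ^ 2 / q := by
  rcases eq_or_ne q 0 with hq | hq
  · simp [hq, h hq]
  · field_simp
    ring

theorem abs_le_add_sq_div {K : Type*} [Field K] [LinearOrder K] [IsStrictOrderedRing K] {q D : K}
    (hq : 0 ≤ q) (h : q = 0 → D = 0) : |D| ≤ q + D ^ 2 / q := by
  have hplus := add_sq_div_self h
  have hminus := add_sq_div_self (D := -D) (q := q) (by simpa using h)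
  have : 0 ≤ D ^ 2 / q := by positivity
  have : 0 ≤ (q + D) ^ 2 / q := by positivity
  have : 0 ≤ (q + -D) ^ 2 / q := by positivity
  rw [neg_sq] at hminus
  exact abs_le.2 ⟨by linarith, by linarith⟩

variable {α : Type*} [MeasurableSpace α] {μ : Measure α}

theorem integrable_of_integrable_sq_div {q D : α → ℝ} (hq0 : ∀ y, 0 ≤ q y)
    (hq : Integrable q μ) (hD : AEStronglyMeasurable D μ) (hDq : ∀ᵐ y ∂μ, q y = 0 → D y = 0)
    (hJ : Integrable (fun y => D y ^ 2 / q y) μ) : Integrable D μ := by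
  refine (hq.add hJ).mono' hD ?_
  filter_upwards [hDq] with y hy using abs_le_add_sq_div (hq0 y) hy

variable {T : Type*} [TopologicalSpace T] [FirstCountableTopology T] {t₀ : T} {q D : T → α → ℝ}

theorem lowerSemicontinuousAt_integral_of_sq_div (hq0 : ∀ t y, 0 ≤ q t y)
    (hq : ∀ t, Integrable (q t) μ) (hD : ∀ t, Integrable (D t) μ)
    (hDq : ∀ t, ∀ᵐ y ∂μ, q t y = 0 → D t y = 0)
    (hJ : ∀ t, Integrable (fun y => D t y ^ 2 / q t y) μ)
    (hcont : ∀ᵐ y ∂μ, ContinuousAt (fun t => q t y) t₀ ∧ ContinuousAt (fun t => D t y) t₀)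
    (hqc : ContinuousAt (fun t => ∫ y, q t y ∂μ) t₀)
    (hJc : ContinuousAt (fun t => ∫ y, D t y ^ 2 / q t y ∂μ) t₀) :
    LowerSemicontinuousAt (fun t => ∫ y, D t y ∂μ) t₀ := by
  have hsquare : ∀ t, (fun y => (q t y + D t y) ^ 2 / q t y) =ᵐ[μ]
      fun y => q t y + 2 * D t y + D t y ^ 2 / q t y := fun t => by
    filter_upwards [hDq t] with y hy using add_sq_div_self hy
  have hint : ∀ t, Integrable (fun y => q t y + 2 * D t y) μ := fun t =>
    (hq t).add ((hD t).const_mul 2)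
  have hlsc : LowerSemicontinuousAt (fun t => ∫ y, (q t y + D t y) ^ 2 / q t y ∂μ) t₀ := by
    refine lowerSemicontinuousAt_integral (fun t y => div_nonneg (sq_nonneg _) (hq0 t y))
      (fun t => ((hint t).add (hJ t)).congr (hsquare t).symm) ?_
    filter_upwards [hcont] with y hy
    exact lowerSemicontinuousAt_sq_div (fun t => hq0 t y) (hy.1.add hy.2) hy.1
  have hexpand : ∀ t, ∫ y, (q t y + D t y) ^ 2 / q t y ∂μ =
      ∫ y, q t y ∂μ + 2 * ∫ y, D t y ∂μ + ∫ y, D t y ^ 2 / q t y ∂μ := fun t => by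
    rw [integral_congr_ae (hsquare t), integral_add (hint t) (hJ t),
      integral_add (hq t) ((hD t).const_mul 2), integral_const_mul]
  have hsolve : (fun t => ∫ y, D t y ∂μ) = fun t => 2⁻¹ * (∫ y, (q t y + D t y) ^ 2 / q t y ∂μ +
      -(∫ y, q t y ∂μ + ∫ y, D t y ^ 2 / q t y ∂μ)) := by
    funext t
    rw [hexpand]
    ring
  rw [hsolve]
  exact (by fun_prop : ContinuousAt (fun x : ℝ => 2⁻¹ * x) _).comp_lowerSemicontinuousAt
    (hlsc.add (hqc.add hJc).neg.lowerSemicontinuousAt)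
    fun x y hxy => mul_le_mul_of_nonneg_left hxy (by norm_num)

theorem continuousAt_integral_of_sq_div (hq0 : ∀ t y, 0 ≤ q t y)
    (hq : ∀ t, Integrable (q t) μ) (hD : ∀ t, Integrable (D t) μ)
    (hDq : ∀ t, ∀ᵐ y ∂μ, q t y = 0 → D t y = 0)
    (hJ : ∀ t, Integrable (fun y => D t y ^ 2 / q t y) μ)
    (hcont : ∀ᵐ y ∂μ, ContinuousAt (fun t => q t y) t₀ ∧ ContinuousAt (fun t => D t y) t₀)
    (hqc : ContinuousAt (fun t => ∫ y, q t y ∂μ) t₀)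
    (hJc : ContinuousAt (fun t => ∫ y, D t y ^ 2 / q t y ∂μ) t₀) :
    ContinuousAt (fun t => ∫ y, D t y ∂μ) t₀ := by
  have hneg : LowerSemicontinuousAt (fun t => ∫ y, -D t y ∂μ) t₀ :=
    lowerSemicontinuousAt_integral_of_sq_div hq0 hq (fun t => (hD t).neg)
      (fun t => by simpa only [neg_eq_zero] using hDq t) (by simpa only [neg_sq] using hJ)
      (hcont.mono fun y hy => ⟨hy.1, hy.2.neg⟩) hqc (by simpa only [neg_sq] using hJc)
  refine continuousAt_iff_lower_upperSemicontinuousAt.2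
    ⟨lowerSemicontinuousAt_integral_of_sq_div hq0 hq hD hDq hJ hcont hqc hJc, ?_⟩
  simpa only [Function.comp_def, integral_neg, neg_neg] using
    continuous_neg.continuousAt.comp_lowerSemicontinuousAt_antitone hneg fun _ _ => neg_le_neg

end Fisher

section Deriv

variable {α : Type*} [MeasurableSpace α] {μ : Measure α} {q : ℝ → α → ℝ}

theorem exists_measurable_uncurry_ae_eq_deriv (hq : ∀ t, Measurable (q t))
    (hdiff : ∀ᵐ y ∂μ, Differentiable ℝ fun t => q t y) :
    ∃ D : ℝ → α → ℝ, Measurable (Function.uncurry D) ∧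
      ∀ᵐ y ∂μ, ∀ t, D t y = deriv (fun s => q s y) t := by
  obtain ⟨A, hAdiff, hAm, hAμ⟩ : ∃ A : Set α, (∀ y ∈ A, Differentiable ℝ fun t => q t y) ∧
      MeasurableSet A ∧ A ∈ ae μ := by
    obtain ⟨N, hN, hNm, hNμ⟩ := exists_measurable_superset_of_null hdiff
    exact ⟨Nᶜ, fun y hy => by_contra fun hcon => hy (hN hcon), hNm.compl,
      compl_mem_ae_iff.2 hNμ⟩
  set p : ℝ → α → ℝ := fun t => A.indicator (q t)
  have hpdiff : ∀ y, Differentiable ℝ fun t => p t y := fun y => by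
    by_cases hy : y ∈ A
    · simpa [p, hy] using hAdiff y hy
    · simp [p, hy]
  have hp : Measurable (Function.uncurry p) :=
    measurable_uncurry_of_continuous_of_measurable (fun y => (hpdiff y).continuous)
      fun t => (hq t).indicator hAm
  refine ⟨fun t y => deriv (fun s => p s y) t, ?_, ?_⟩
  · have hstep : Tendsto (fun n : ℕ => 1 / ((n : ℝ) + 1)) atTop (𝓝[≠] 0) :=
      tendsto_nhdsWithin_iff.2 ⟨tendsto_one_div_add_atTop_nhds_zero_nat,
        Eventually.of_forall fun n => Nat.one_div_pos_of_nat.ne'⟩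
    refine measurable_of_tendsto_metrizable
      (f := fun (n : ℕ) (z : ℝ × α) => (1 / ((n : ℝ) + 1))⁻¹ •
        (p (z.1 + 1 / ((n : ℝ) + 1)) z.2 - p z.1 z.2)) (fun n => ?_) ?_
    · have hshift : Measurable fun z : ℝ × α => (z.1 + 1 / ((n : ℝ) + 1), z.2) := by fun_prop
      exact ((hp.comp hshift).sub hp).const_smul (1 / ((n : ℝ) + 1))⁻¹
    · exact tendsto_pi_nhds.2 fun z =>
        (hasDerivAt_iff_tendsto_slope_zero.1 (hpdiff z.2 z.1).hasDerivAt).comp hstep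
  · filter_upwards [hAμ] with y hy t
    simp [p, hy]

theorem hasDerivAt_integral_of_continuous_integral_deriv [SFinite μ]
    (hq : ∀ t, Measurable (q t)) (hqint : ∀ t, Integrable (q t) μ)
    (hdiff : ∀ᵐ y ∂μ, ContDiff ℝ 1 fun t => q t y)
    (hDint : ∀ t, Integrable (fun y => deriv (fun s => q s y) t) μ)
    {G : ℝ → ℝ} (hGc : Continuous G) (hDG : ∀ t, ∫ y, ‖deriv (fun s => q s y) t‖ ∂μ ≤ G t)
    (hDc : Continuous fun t => ∫ y, deriv (fun s => q s y) t ∂μ) (t₀ : ℝ) :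
    HasDerivAt (fun t => ∫ y, q t y ∂μ) (∫ y, deriv (fun s => q s y) t₀ ∂μ) t₀ := by
  obtain ⟨D, hDm, hD⟩ := exists_measurable_uncurry_ae_eq_deriv hq
    (hdiff.mono fun y hy => hy.differentiable one_ne_zero)
  have hDt : ∀ t, D t =ᵐ[μ] fun y => deriv (fun s => q s y) t := fun t =>
    hD.mono fun y hy => hy t
  have hprod : ∀ t, Integrable (Function.uncurry D)
      ((volume.restrict (Set.uIoc t₀ t)).prod μ) := fun t => by
    rw [integrable_prod_iff hDm.aestronglyMeasurable]
    refine ⟨ae_of_all _ fun s => (hDint s).congr (hDt s).symm, ?_⟩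
    refine (intervalIntegrable_iff.1 (hGc.intervalIntegrable t₀ t)).mono'
      hDm.aestronglyMeasurable.norm.integral_prod_right' (ae_of_all _ fun s => ?_)
    rw [Real.norm_of_nonneg (integral_nonneg fun y => norm_nonneg _)]
    exact (integral_congr_ae ((hDt s).fun_comp norm)).trans_le (hDG s)
  have hFTC : ∀ t, ∫ y, q t y ∂μ =
      ∫ y, q t₀ y ∂μ + ∫ s in t₀..t, ∫ y, deriv (fun r => q r y) s ∂μ := fun t => by
    have hae : (fun y => ∫ s in t₀..t, D s y) =ᵐ[μ] fun y => q t y - q t₀ y := by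
      filter_upwards [hD, hdiff] with y hy hy'
      simp only [hy]
      exact intervalIntegral.integral_deriv_eq_sub
        (fun s _ => (hy'.differentiable one_ne_zero).differentiableAt)
        (hy'.continuous_deriv_one.intervalIntegrable t₀ t)
    simp only [← integral_congr_ae (hDt _)]
    rw [intervalIntegral_integral_swap (hprod t), integral_congr_ae hae,
      integral_sub (hqint t) (hqint t₀), add_sub_cancel]
  rw [funext hFTC]
  exact ((hDc.integral_hasStrictDerivAt t₀ t₀).hasDerivAt).const_add _

theorem integral_deriv_eq_zero [SFinite μ]
    (hq : ∀ t, Measurable (q t)) (hq0 : ∀ t y, 0 ≤ q t y) (hqint : ∀ t, Integrable (q t) μ)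
    {c : ℝ} (hqc : ∀ t, ∫ y, q t y ∂μ = c)
    (hdiff : ∀ᵐ y ∂μ, ContDiff ℝ 1 fun t => q t y)
    (hJ : ∀ t, Integrable (fun y => deriv (fun s => q s y) t ^ 2 / q t y) μ)
    (hJc : Continuous fun t => ∫ y, deriv (fun s => q s y) t ^ 2 / q t y ∂μ) (t₀ : ℝ) :
    ∫ y, deriv (fun s => q s y) t₀ ∂μ = 0 := by
  have hzero : ∀ t y, q t y = 0 → deriv (fun s => q s y) t = 0 := fun t y h0 =>
    IsLocalMin.deriv_eq_zero (Eventually.of_forall fun s => h0.trans_le (hq0 s y))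
  have hDm : ∀ t, AEStronglyMeasurable (fun y => deriv (fun s => q s y) t) μ := fun t => by
    obtain ⟨D, hDm, hD⟩ := exists_measurable_uncurry_ae_eq_deriv hq
      (hdiff.mono fun y hy => hy.differentiable one_ne_zero)
    exact ⟨D t, (hDm.comp measurable_prodMk_left).stronglyMeasurable,
      hD.mono fun y hy => (hy t).symm⟩
  have hDint : ∀ t, Integrable (fun y => deriv (fun s => q s y) t) μ := fun t =>
    integrable_of_integrable_sq_div (hq0 t) (hqint t) (hDm t) (ae_of_all _ (hzero t)) (hJ t)
  have hDc : Continuous fun t => ∫ y, deriv (fun s => q s y) t ∂μ :=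
    continuous_iff_continuousAt.2 fun t =>
      continuousAt_integral_of_sq_div hq0 hqint hDint (fun t => ae_of_all _ (hzero t)) hJ
        (hdiff.mono fun y hy => ⟨hy.continuous.continuousAt, hy.continuous_deriv_one.continuousAt⟩)
        (by simpa only [hqc] using continuousAt_const) hJc.continuousAt
  have hbound : ∀ t, ∫ y, ‖deriv (fun s => q s y) t‖ ∂μ ≤
      c + ∫ y, deriv (fun s => q s y) t ^ 2 / q t y ∂μ := fun t => by
    rw [← hqc t, ← integral_add (hqint t) (hJ t)]
    exact integral_mono (hDint t).norm ((hqint t).add (hJ t)) fun y =>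
      abs_le_add_sq_div (hq0 t y) (hzero t y)
  have hderiv := hasDerivAt_integral_of_continuous_integral_deriv hq hqint hdiff hDint
    (continuous_const.add hJc) hbound hDc t₀
  simp only [hqc] at hderiv
  exact hderiv.unique (hasDerivAt_const t₀ c)

variable {E : Type*} [NormedAddCommGroup E] [NormedSpace ℝ E] {Θ : Set E} {p : E → α → ℝ}

theorem integral_fderiv_eq_zero [SFinite μ] (hΘ : IsOpen Θ)
    (hp : ∀ θ ∈ Θ, Measurable (p θ)) (hp0 : ∀ θ ∈ Θ, ∀ y, 0 ≤ p θ y)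
    (hpint : ∀ θ ∈ Θ, Integrable (p θ) μ) {c : ℝ} (hpc : ∀ θ ∈ Θ, ∫ y, p θ y ∂μ = c)
    (hdiff : ∀ᵐ y ∂μ, ContDiffOn ℝ 1 (fun θ => p θ y) Θ) (v : E)
    (hJ : ∀ θ ∈ Θ, Integrable (fun y => fderiv ℝ (fun η => p η y) θ v ^ 2 / p θ y) μ)
    (hJc : ContinuousOn (fun θ => ∫ y, fderiv ℝ (fun η => p η y) θ v ^ 2 / p θ y ∂μ) Θ)
    {θ₀ : E} (hθ₀ : θ₀ ∈ Θ) : ∫ y, fderiv ℝ (fun η => p η y) θ₀ v ∂μ = 0 := by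
  obtain ⟨r, hr, hline⟩ : ∃ r > 0, ∀ s : ℝ, |s| ≤ r → θ₀ + s • v ∈ Θ := by
    have hnhds : {s : ℝ | θ₀ + s • v ∈ Θ} ∈ 𝓝 0 :=
      (hΘ.preimage (by fun_prop : Continuous fun s : ℝ => θ₀ + s • v)).mem_nhds (by simpa)
    obtain ⟨r, hr, hball⟩ := Metric.nhds_basis_closedBall.mem_iff.1 hnhds
    exact ⟨r, hr, fun s hs => hball (by simpa using hs)⟩
  -- The sine gives a smooth path through `θ₀` that is defined for all times and stays in `Θ`.
  set γ : ℝ → E := fun t => θ₀ + (r * Real.sin t) • v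
  have hγΘ : ∀ t, γ t ∈ Θ := fun t => hline _ <| by
    rw [abs_mul, abs_of_pos hr]
    exact mul_le_of_le_one_right hr.le (Real.abs_sin_le_one t)
  have hγ : ContDiff ℝ 1 γ := by fun_prop
  have hγderiv : ∀ t, HasDerivAt γ ((r * Real.cos t) • v) t := fun t =>
    (((Real.hasDerivAt_sin t).const_mul r).smul_const v).const_add θ₀
  have hderiv : ∀ t, (fun y => deriv (fun s => p (γ s) y) t) =ᵐ[μ]
      fun y => r * Real.cos t * fderiv ℝ (fun η => p η y) (γ t) v := fun t => by
    filter_upwards [hdiff] with y hy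
    have hpy := ((hy.differentiableOn one_ne_zero).differentiableAt
      (hΘ.mem_nhds (hγΘ t))).hasFDerivAt.comp_hasDerivAt t (hγderiv t)
    rw [map_smul, smul_eq_mul] at hpy
    exact hpy.deriv
  have hJγ : ∀ t, (fun y => deriv (fun s => p (γ s) y) t ^ 2 / p (γ t) y) =ᵐ[μ] fun y =>
      (r * Real.cos t) ^ 2 * (fderiv ℝ (fun η => p η y) (γ t) v ^ 2 / p (γ t) y) := fun t => by
    filter_upwards [hderiv t] with y hy
    rw [hy, mul_pow, mul_div_assoc]
  have hpath : ∫ y, deriv (fun s => p (γ s) y) 0 ∂μ = 0 := by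
    refine integral_deriv_eq_zero (fun t => hp _ (hγΘ t)) (fun t => hp0 _ (hγΘ t))
      (fun t => hpint _ (hγΘ t)) (fun t => hpc _ (hγΘ t))
      (hdiff.mono fun y hy => hy.comp_contDiff hγ hγΘ)
      (fun t => ((hJ _ (hγΘ t)).const_mul _).congr (hJγ t).symm) ?_ 0
    simp only [integral_congr_ae (hJγ _), integral_const_mul]
    exact (by fun_prop : Continuous fun t => (r * Real.cos t) ^ 2).mul
      (hJc.comp_continuous hγ.continuous hγΘ)
  rw [integral_congr_ae (hderiv 0), integral_const_mul] at hpath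
  simpa [γ, hr.ne'] using hpath

end Deriv

section Law

theorem integral_law {E : Type*} [NormedAddCommGroup E] [NormedSpace ℝ E] {g : ℝ → ℝ}
    (hg : Measurable g) (hg0 : ∀ x, 0 ≤ g x) (φ : ℝ → E) :
    ∫ x, φ x ∂law g = ∫ x, g x • φ x := by
  rw [law, integral_withDensity_eq_integral_toReal_smul hg.ennreal_ofReal
    (ae_of_all _ fun _ => ENNReal.ofReal_lt_top)]
  simp only [ENNReal.toReal_ofReal (hg0 _)]

theorem integrable_law_iff {E : Type*} [NormedAddCommGroup E] [NormedSpace ℝ E] {g : ℝ → ℝ}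
    (hg : Measurable g) (hg0 : ∀ x, 0 ≤ g x) (φ : ℝ → E) :
    Integrable φ (law g) ↔ Integrable (fun x => g x • φ x) volume := by
  rw [law, integrable_withDensity_iff_integrable_smul' hg.ennreal_ofReal
    (ae_of_all _ fun _ => ENNReal.ofReal_lt_top)]
  simp only [ENNReal.toReal_ofReal (hg0 _)]

variable {g h : ℝ → ℝ}

theorem IsDensity.isProbabilityMeasure_law (hg : IsDensity g) : IsProbabilityMeasure (law g) := by
  refine ⟨?_⟩
  rw [law, withDensity_apply _ MeasurableSet.univ, Measure.restrict_univ,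
    ← ofReal_integral_eq_lintegral_ofReal hg.integrable (ae_of_all _ hg.nonneg),
    hg.integral_eq_one, ENNReal.ofReal_one]

theorem IsDensity.convolution (hg : IsDensity g) (hh : IsDensity h) :
    IsDensity fun y => ∫ s, g s * h (y - s) where
  measurable := by
    have hprod : Measurable (Function.uncurry fun y s => g s * h (y - s)) :=
      (hg.measurable.comp measurable_snd).mul
        (hh.measurable.comp (measurable_fst.sub measurable_snd))
    exact hprod.stronglyMeasurable.integral_prod_right.measurable
  nonneg y := integral_nonneg fun s => mul_nonneg (hg.nonneg _) (hh.nonneg _)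
  integrable := hg.integrable.integrable_convolution (ContinuousLinearMap.mul ℝ ℝ) hh.integrable
  integral_eq_one := by
    have hconv := integral_convolution (μ := volume) (ν := volume) (ContinuousLinearMap.mul ℝ ℝ)
      hg.integrable hh.integrable
    rw [hg.integral_eq_one, hh.integral_eq_one] at hconv
    exact hconv.trans (mul_one 1)

theorem IsDensity.law_conv_law (hg : IsDensity g) (hh : IsDensity h) :
    law g ∗ law h = law fun y => ∫ s, g s * h (y - s) := by
  rw [law, law, conv_withDensity_eq_lconvolution hg.measurable.ennreal_ofReal
    hh.measurable.ennreal_ofReal, law]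
  refine withDensity_congr_ae ?_
  filter_upwards [hg.integrable.ae_convolution_exists (ContinuousLinearMap.mul ℝ ℝ) hh.integrable]
    with y hy
  have hint : Integrable (fun s => g s * h (y - s)) volume := hy
  rw [lconvolution_def, ofReal_integral_eq_lintegral_ofReal hint
    (ae_of_all _ fun s => mul_nonneg (hg.nonneg _) (hh.nonneg _))]
  refine lintegral_congr fun s => ?_
  rw [ENNReal.ofReal_mul (hg.nonneg _), neg_add_eq_sub]

end Law

section Score

variable {k : ℕ} {f : EuclideanSpace ℝ (Fin k) → ℝ → ℝ} {h : ℝ → ℝ}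
  {Θ : Set (EuclideanSpace ℝ (Fin k))} {θ : EuclideanSpace ℝ (Fin k)}

theorem isDensity_obsDensity (hf : IsDensity (f θ)) (hh : IsDensity h) :
    IsDensity (obsDensity f h θ) :=
  hf.convolution hh

theorem gradient_apply_eq_fderiv_single {ι : Type*} [Fintype ι] [DecidableEq ι]
    (g : EuclideanSpace ℝ ι → ℝ) (x : EuclideanSpace ℝ ι) (i : ι) :
    gradient g x i = fderiv ℝ g x (EuclideanSpace.single i 1) := by
  rw [← inner_gradient_left, real_inner_comm, EuclideanSpace.inner_single_left, map_one, one_mul]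

theorem score_apply_of_pos {y : ℝ} (hq : 0 < obsDensity f h θ y) (i : Fin k) :
    score f h θ y i = (obsDensity f h θ y)⁻¹ *
      fderiv ℝ (fun η => obsDensity f h η y) θ (EuclideanSpace.single i 1) := by
  rw [score, if_pos hq, PiLp.smul_apply, gradient_apply_eq_fderiv_single, smul_eq_mul]

theorem obsDensity_mul_score_apply {y : ℝ} (hΘ : Θ ∈ 𝓝 θ) (hq0 : ∀ η ∈ Θ, 0 ≤ obsDensity f h η y)
    (i : Fin k) : obsDensity f h θ y * score f h θ y i =
      fderiv ℝ (fun η => obsDensity f h η y) θ (EuclideanSpace.single i 1) := by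
  rcases (hq0 θ (mem_of_mem_nhds hΘ)).eq_or_lt with hq | hq
  · have hmin : IsLocalMin (fun η => obsDensity f h η y) θ :=
      mem_of_superset hΘ fun η hη => hq.symm.trans_le (hq0 η hη)
    rw [← hq, zero_mul, hmin.fderiv_eq_zero, zero_apply]
  · rw [score_apply_of_pos hq, mul_inv_cancel_left₀ hq.ne']

theorem obsDensity_mul_score_apply_sq {y : ℝ} (hq0 : 0 ≤ obsDensity f h θ y) (i : Fin k) :
    obsDensity f h θ y * (score f h θ y i * score f h θ y i) =
      fderiv ℝ (fun η => obsDensity f h η y) θ (EuclideanSpace.single i 1) ^ 2 /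
        obsDensity f h θ y := by
  rcases hq0.eq_or_lt with hq | hq
  · simp [← hq]
  · rw [score_apply_of_pos hq]
    field_simp

theorem integrable_fderiv_obsDensity_sq_div (hq : IsDensity (obsDensity f h θ))
    (hs : MemLp (score f h θ) 2 (obsLaw f h θ)) (i : Fin k) :
    Integrable fun y => fderiv ℝ (fun η => obsDensity f h η y) θ (EuclideanSpace.single i 1) ^ 2 /
      obsDensity f h θ y := by
  have hsq := (hs.eval_piLp i).integrable_mul (hs.eval_piLp i)
  rw [obsLaw, integrable_law_iff hq.measurable hq.nonneg] at hsq
  exact hsq.congr (ae_of_all _ fun y => obsDensity_mul_score_apply_sq (hq.nonneg y) i)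

theorem integral_fderiv_obsDensity_sq_div (hq : IsDensity (obsDensity f h θ)) (i : Fin k) :
    ∫ y, fderiv ℝ (fun η => obsDensity f h η y) θ (EuclideanSpace.single i 1) ^ 2 /
      obsDensity f h θ y = fisherInformation f h θ i i := by
  rw [fisherInformation, Matrix.of_apply, obsLaw, integral_law hq.measurable hq.nonneg]
  simp only [smul_eq_mul, obsDensity_mul_score_apply_sq (hq.nonneg _)]

theorem IsRegular.integral_score_eq_zero (hreg : IsRegular f h Θ) (hΘ : IsOpen Θ)
    (hf : ∀ η ∈ Θ, IsDensity (f η)) (hh : IsDensity h) (hθ : θ ∈ Θ) (i : Fin k) :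
    ∫ y, score f h θ y i ∂obsLaw f h θ = 0 := by
  have hq : ∀ η ∈ Θ, IsDensity (obsDensity f h η) := fun η hη => isDensity_obsDensity (hf η hη) hh
  have hscore : ∀ y, obsDensity f h θ y • score f h θ y i =
      fderiv ℝ (fun η => obsDensity f h η y) θ (EuclideanSpace.single i 1) := fun y =>
    obsDensity_mul_score_apply (hΘ.mem_nhds hθ) (fun η hη => (hq η hη).nonneg y) i
  simp only [obsLaw, integral_law (hq θ hθ).measurable (hq θ hθ).nonneg, hscore]
  refine integral_fderiv_eq_zero hΘ (fun η hη => (hq η hη).measurable)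
    (fun η hη => (hq η hη).nonneg) (fun η hη => (hq η hη).integrable)
    (fun η hη => (hq η hη).integral_eq_one) hreg.contDiffOn _
    (fun η hη => integrable_fderiv_obsDensity_sq_div (hq η hη) (hreg.memLp_score η hη) i) ?_ hθ
  exact ((continuous_id.matrix_elem i i).comp_continuousOn hreg.continuousOn).congr fun η hη =>
    integral_fderiv_obsDensity_sq_div (hq η hη) i

end Score

section IIDSum

variable {Ω 𝓨 : Type*} [MeasurableSpace Ω] [MeasurableSpace 𝓨] {P : Measure Ω} {ν : Measure 𝓨}
  {φ ψ : 𝓨 → ℝ}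

theorem memLp_comp_of_hasLaw {Z : Ω → 𝓨} (hZ : HasLaw Z ν P) {p : ENNReal} (hφ : MemLp φ p ν) :
    MemLp (fun ω => φ (Z ω)) p P :=
  (hZ.map_eq.symm ▸ hφ : MemLp φ p (P.map Z)).comp_of_map hZ.aemeasurable

variable {Y : ℕ → Ω → 𝓨}

theorem iIndepFun_comp_of_hasLaw (hY : ∀ i, HasLaw (Y i) ν P) (hind : iIndepFun Y P)
    (hφ : AEMeasurable φ ν) : iIndepFun (fun i ω => φ (Y i ω)) P :=
  hind.comp₀ (fun _ => φ) (fun i => (hY i).aemeasurable) fun i => (hY i).map_eq.symm ▸ hφ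

theorem integral_comp_mul_comp (hY : ∀ i, HasLaw (Y i) ν P) (hind : iIndepFun Y P)
    (hφ : AEStronglyMeasurable φ ν) (hψ : AEStronglyMeasurable ψ ν) (hφ0 : ∫ y, φ y ∂ν = 0)
    (i j : ℕ) :
    ∫ ω, φ (Y i ω) * ψ (Y j ω) ∂P = if i = j then ∫ y, φ y * ψ y ∂ν else 0 := by
  split_ifs with hij
  · subst hij
    exact (hY i).integral_comp (f := fun y => φ y * ψ y) (hφ.mul hψ)
  · have hmean : ∫ ω, φ (Y i ω) ∂P = 0 := ((hY i).integral_comp hφ).trans hφ0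
    have hφi : AEStronglyMeasurable φ (P.map (Y i)) := (hY i).map_eq.symm ▸ hφ
    have hψj : AEStronglyMeasurable ψ (P.map (Y j)) := (hY j).map_eq.symm ▸ hψ
    have hindep := (hind.indepFun hij).comp₀ (hY i).aemeasurable (hY j).aemeasurable
      hφi.aemeasurable hψj.aemeasurable
    have hmul := hindep.integral_fun_mul_eq_mul_integral
      (hφi.comp_aemeasurable (hY i).aemeasurable) (hψj.comp_aemeasurable (hY j).aemeasurable)
    simp only [Function.comp_apply] at hmul
    rw [hmul, hmean, zero_mul]

theorem integral_inv_sqrt_mul_sum_mul (hY : ∀ i, HasLaw (Y i) ν P) (hind : iIndepFun Y P)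
    (hφ : MemLp φ 2 ν) (hψ : MemLp ψ 2 ν) (hφ0 : ∫ y, φ y ∂ν = 0) {n : ℕ} (hn : n ≠ 0) :
    ∫ ω, ((√n)⁻¹ * ∑ j ∈ Finset.range n, φ (Y j ω)) *
      ((√n)⁻¹ * ∑ j ∈ Finset.range n, ψ (Y j ω)) ∂P = ∫ y, φ y * ψ y ∂ν := by
  have hint : ∀ i j, Integrable (fun ω => φ (Y i ω) * ψ (Y j ω)) P := fun i j =>
    (memLp_comp_of_hasLaw (hY i) hφ).integrable_mul (memLp_comp_of_hasLaw (hY j) hψ)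
  simp only [mul_mul_mul_comm (√n)⁻¹, Finset.sum_mul_sum]
  rw [integral_const_mul,
    integral_finsetSum _ fun i _ => integrable_finsetSum _ fun j _ => hint i j]
  simp only [integral_finsetSum _ fun j _ => hint _ j,
    integral_comp_mul_comp hY hind hφ.aestronglyMeasurable hψ.aestronglyMeasurable hφ0]
  rw [Finset.sum_congr rfl fun i hi => by rw [Finset.sum_ite_eq, if_pos hi], Finset.sum_const,
    Finset.card_range, nsmul_eq_mul, ← mul_inv, Real.mul_self_sqrt n.cast_nonneg,
    inv_mul_cancel_left₀ (Nat.cast_ne_zero.2 hn)]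

theorem tendstoInDistribution_inv_mul_sq_inv_sqrt_mul_sum [IsProbabilityMeasure P]
    {X : ℕ → Ω → ℝ} {v : ℝ} (hv : 0 < v) (hmean : P[X 0] = 0) (hvar : P[X 0 ^ 2] = v)
    (hind : iIndepFun X P) (hident : ∀ i, IdentDistrib (X i) (X 0) P P) :
    TendstoInDistribution
      (fun (n : ℕ) ω => v⁻¹ * ((√n)⁻¹ * ∑ j ∈ Finset.range n, X j ω) ^ 2) atTop id
      (fun _ => P) (chiSquare 1) := by
  have hclt := tendstoInDistribution_inv_sqrt_mul_sum
    (X := fun i ω => (√v)⁻¹ * X i ω)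
    (measurePreserving_eval (fun _ : Fin 1 => gaussianReal 0 1) 0).hasLaw
    (by rw [integral_const_mul, hmean, mul_zero])
    (by
      simp only [Pi.pow_apply, mul_pow, inv_pow, Real.sq_sqrt hv.le] at hvar ⊢
      rw [integral_const_mul, hvar, inv_mul_cancel₀ hv.ne'])
    (hind.comp (fun _ x => (√v)⁻¹ * x) fun _ => by fun_prop)
    fun i => (hident i).comp (u := fun x => (√v)⁻¹ * x) (by fun_prop)
  have hsq := hclt.continuous_comp (continuous_pow 2)
  have hlaw : (Measure.pi fun _ : Fin 1 => gaussianReal 0 1).map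
      ((fun x : ℝ => x ^ 2) ∘ fun z => z 0) = (chiSquare 1).map id := by
    simp [chiSquare, Function.comp_def]
  have hchi : TendstoInDistribution (fun (n : ℕ) => (fun x : ℝ => x ^ 2) ∘
      fun ω => (√n)⁻¹ * ∑ j ∈ Finset.range n, (√v)⁻¹ * X j ω) atTop id (fun _ => P)
      (chiSquare 1) := by
    refine ⟨hsq.forall_aemeasurable, aemeasurable_id, ?_⟩
    simpa only [hlaw] using hsq.tendsto
  refine hchi.congr (fun n => ae_of_all _ fun ω => ?_) ae_eq_rfl
  rw [Function.comp_apply, ← Finset.mul_sum, mul_left_comm, mul_pow, inv_pow, Real.sq_sqrt hv.le]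

theorem tendsto_measure_le_of_integral_le [IsFiniteMeasure P] {U : ℕ → Ω → ℝ} {B : ℝ} {c : ℕ → ℝ}
    (hU0 : ∀ n, 0 ≤ U n) (hU : ∀ n, Integrable (U n) P) (hB : ∀ᶠ n in atTop, ∫ ω, U n ω ∂P ≤ B)
    (hc : Tendsto c atTop atTop) : Tendsto (fun n => P {ω | c n ≤ U n ω}) atTop (𝓝 0) := by
  have hlim : Tendsto (fun n => ENNReal.ofReal (B / c n)) atTop (𝓝 0) := by
    rw [← ENNReal.ofReal_zero]
    exact ENNReal.tendsto_ofReal (hc.const_div_atTop B)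
  refine tendsto_of_tendsto_of_tendsto_of_le_of_le' tendsto_const_nhds hlim
    (Eventually.of_forall fun _ => zero_le) ?_
  filter_upwards [hc.eventually_gt_atTop 0, hB] with n hn hBn
  have hmarkov := mul_meas_ge_le_integral_of_nonneg (ae_of_all P (hU0 n)) (hU n) (c n)
  rw [← ofReal_measureReal]
  exact ENNReal.ofReal_le_ofReal ((le_div_iff₀' hn).2 (hmarkov.trans hBn))

end IIDSum

section QuadraticForm

variable {Ω ι : Type*} [MeasurableSpace Ω] {P : Measure Ω}

theorem posSemidef_of_integral_mul [Finite ι] {φ : ι → Ω → ℝ} (hφ : ∀ i, MemLp (φ i) 2 P) :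
    (Matrix.of fun i j => ∫ ω, φ i ω * φ j ω ∂P).PosSemidef := by
  have hgram : (Matrix.of fun i j => ∫ ω, φ i ω * φ j ω ∂P) =
      Matrix.gram ℝ fun i => (hφ i).toLp (φ i) := by
    ext i j
    rw [Matrix.of_apply, Matrix.gram_apply, L2.inner_def]
    refine integral_congr_ae ?_
    filter_upwards [(hφ i).coeFn_toLp, (hφ j).coeFn_toLp] with ω hi hj
    rw [hi, hj, RCLike.inner_apply, conj_trivial, mul_comm]
  exact hgram ▸ Matrix.posSemidef_gram ℝ _

variable [Fintype ι] {Z : Ω → ι → ℝ}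

theorem integrable_dotProduct_mulVec_self (hZ : ∀ i, MemLp (fun ω => Z ω i) 2 P)
    (A : Matrix ι ι ℝ) : Integrable (fun ω => Z ω ⬝ᵥ (A *ᵥ Z ω)) P := by
  simp only [dotProduct, Matrix.mulVec, Finset.mul_sum]
  refine integrable_finsetSum _ fun i _ => integrable_finsetSum _ fun j _ => ?_
  simp only [mul_left_comm _ (A i j)]
  exact ((hZ i).integrable_mul (hZ j)).const_mul _

theorem integral_dotProduct_mulVec_self (hZ : ∀ i, MemLp (fun ω => Z ω i) 2 P)
    (A : Matrix ι ι ℝ) :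
    ∫ ω, Z ω ⬝ᵥ (A *ᵥ Z ω) ∂P =
      (A * Matrix.of fun i j => ∫ ω, Z ω i * Z ω j ∂P).trace := by
  have hint : ∀ i j, Integrable (fun ω => A i j * (Z ω j * Z ω i)) P := fun i j =>
    ((hZ j).integrable_mul (hZ i)).const_mul _
  have hexpand : ∀ ω, Z ω ⬝ᵥ (A *ᵥ Z ω) = ∑ i, ∑ j, A i j * (Z ω j * Z ω i) := fun ω => by
    simp only [dotProduct, Matrix.mulVec, Finset.mul_sum]
    exact Finset.sum_congr rfl fun i _ => Finset.sum_congr rfl fun j _ => by ring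
  simp only [hexpand, Matrix.trace, Matrix.diag_apply, Matrix.mul_apply, Matrix.of_apply]
  rw [integral_finsetSum _ fun i _ => integrable_finsetSum _ fun j _ => hint i j]
  simp only [integral_finsetSum _ fun j _ => hint _ j, integral_const_mul]

end QuadraticForm

section ScoreStatistic

variable {Ω : Type*} [MeasurableSpace Ω] {P : Measure Ω} {k : ℕ}
  {f : EuclideanSpace ℝ (Fin k) → ℝ → ℝ} {h : ℝ → ℝ} {θ : EuclideanSpace ℝ (Fin k)}
  {Y : ℕ → Ω → ℝ}

theorem posDef_fisherInformation (hs : MemLp (score f h θ) 2 (obsLaw f h θ))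
    (hdet : IsUnit (fisherInformation f h θ).det) : (fisherInformation f h θ).PosDef :=
  (posSemidef_of_integral_mul fun i => hs.eval_piLp i).posDef_iff_det_ne_zero.2 hdet.ne_zero

theorem scoreStatistic_nonneg (hI : (fisherInformation f h 0).PosDef) (n : ℕ) (y : ℕ → ℝ) :
    0 ≤ scoreStatistic f h n y := by
  simpa only [scoreStatistic, star_trivial] using
    hI.inv.posSemidef.dotProduct_mulVec_nonneg (normalizedScore f h n y)

theorem memLp_normalizedScore (hY : ∀ i, HasLaw (Y i) (obsLaw f h 0) P)
    (hs : MemLp (score f h 0) 2 (obsLaw f h 0)) (n : ℕ) (i : Fin k) :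
    MemLp (fun ω => normalizedScore f h n (fun j => Y j ω) i) 2 P :=
  (memLp_finsetSum _ fun j _ => memLp_comp_of_hasLaw (hY j) (hs.eval_piLp i)).const_mul _

theorem integrable_scoreStatistic (hY : ∀ i, HasLaw (Y i) (obsLaw f h 0) P)
    (hs : MemLp (score f h 0) 2 (obsLaw f h 0)) (n : ℕ) :
    Integrable (fun ω => scoreStatistic f h n fun j => Y j ω) P :=
  integrable_dotProduct_mulVec_self (memLp_normalizedScore hY hs n) _

theorem integral_scoreStatistic (hY : ∀ i, HasLaw (Y i) (obsLaw f h 0) P) (hind : iIndepFun Y P)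
    (hs : MemLp (score f h 0) 2 (obsLaw f h 0))
    (hs0 : ∀ i, ∫ y, score f h 0 y i ∂obsLaw f h 0 = 0)
    (hdet : IsUnit (fisherInformation f h 0).det) {n : ℕ} (hn : n ≠ 0) :
    ∫ ω, scoreStatistic f h n (fun j => Y j ω) ∂P = k := by
  have hcov : (Matrix.of fun i j => ∫ ω, normalizedScore f h n (fun j => Y j ω) i *
      normalizedScore f h n (fun j => Y j ω) j ∂P) = fisherInformation f h 0 := by
    ext i j
    exact integral_inv_sqrt_mul_sum_mul hY hind (hs.eval_piLp i) (hs.eval_piLp j) (hs0 i) hn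
  simp only [scoreStatistic]
  rw [integral_dotProduct_mulVec_self (memLp_normalizedScore hY hs n), hcov,
    Matrix.nonsing_inv_mul _ hdet, Matrix.trace_one, Fintype.card_fin]

theorem tendsto_measure_le_scoreStatistic [IsFiniteMeasure P]
    (hY : ∀ i, HasLaw (Y i) (obsLaw f h 0) P) (hind : iIndepFun Y P)
    (hs : MemLp (score f h 0) 2 (obsLaw f h 0))
    (hs0 : ∀ i, ∫ y, score f h 0 y i ∂obsLaw f h 0 = 0)
    (hdet : IsUnit (fisherInformation f h 0).det) {c : ℕ → ℝ} (hc : Tendsto c atTop atTop) :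
    Tendsto (fun n => P {ω | c n ≤ scoreStatistic f h n fun j => Y j ω}) atTop (𝓝 0) :=
  tendsto_measure_le_of_integral_le
    (fun n _ => scoreStatistic_nonneg (posDef_fisherInformation hs hdet) n _)
    (integrable_scoreStatistic hY hs)
    ((eventually_ne_atTop 0).mono fun _ hn =>
      (integral_scoreStatistic hY hind hs hs0 hdet hn).le) hc

theorem scoreStatistic_fin_one (f : EuclideanSpace ℝ (Fin 1) → ℝ → ℝ) (h : ℝ → ℝ) (n : ℕ)
    (y : ℕ → ℝ) :
    scoreStatistic f h n y = (fisherInformation f h 0 0 0)⁻¹ * normalizedScore f h n y 0 ^ 2 := by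
  simp [scoreStatistic, dotProduct, Matrix.mulVec, sq, mul_left_comm]

theorem tendstoInDistribution_scoreStatistic_fin_one [IsProbabilityMeasure P]
    {f : EuclideanSpace ℝ (Fin 1) → ℝ → ℝ} (hY : ∀ i, HasLaw (Y i) (obsLaw f h 0) P)
    (hind : iIndepFun Y P) (hs : MemLp (score f h 0) 2 (obsLaw f h 0))
    (hs0 : ∫ y, score f h 0 y 0 ∂obsLaw f h 0 = 0)
    (hdet : IsUnit (fisherInformation f h 0).det) :
    TendstoInDistribution (fun n ω => scoreStatistic f h n fun j => Y j ω) atTop id (fun _ => P)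
      (chiSquare 1) := by
  have hφ := (hs.eval_piLp 0).aestronglyMeasurable
  simp only [scoreStatistic_fin_one, normalizedScore]
  refine tendstoInDistribution_inv_mul_sq_inv_sqrt_mul_sum
    (X := fun i ω => score f h 0 (Y i ω) 0) (posDef_fisherInformation hs hdet).diag_pos
    (((hY 0).integral_comp hφ).trans hs0) ?_ (iIndepFun_comp_of_hasLaw hY hind hφ.aemeasurable)
    fun i => ((hY i).identDistrib (hY 0)).comp_of_aemeasurable
      (u := fun y => score f h 0 y 0) ((hY i).map_eq.symm ▸ hφ.aemeasurable)
  simp only [fisherInformation, Matrix.of_apply, Pi.pow_apply, ← sq]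
  exact (hY 0).integral_comp (f := fun y => score f h 0 y 0 ^ 2) (hφ.pow 2)

end ScoreStatistic

section Selection

variable {d : ℕ} {u v p : ℕ → ℝ}

theorem maximizers_congr (huv : ∀ k, 1 ≤ k → k ≤ d → u k = v k) :
    maximizers d u p = maximizers d v p := by
  ext k
  refine and_congr_right fun h1 => and_congr_right fun hd => forall₃_congr fun j hj1 hjd => ?_
  rw [huv k h1 hd, huv j hj1 hjd]

theorem measurableSet_mem_maximizers (d : ℕ) (p : ℕ → ℝ) (m : ℕ) :
    MeasurableSet {u | m ∈ maximizers d u p} := by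
  refine measurableSet_setOfPred.2 (measurable_const.and (measurable_const.and ?_))
  refine Measurable.forall fun j => measurable_const.imp (measurable_const.imp ?_)
  exact measurableSet_setOfPred.1 (measurableSet_le (by fun_prop) (by fun_prop))

open Classical in
theorem measurable_selection (hd : 1 ≤ d) (p : ℕ → ℝ) :
    Measurable fun u => selection d u p := by
  have hne : ∀ u, ∃ m, m ∈ maximizers d u p := fun u => ⟨_, (selection_isLeast hd u p).1⟩
  have hfind : ∀ u, selection d u p = Nat.find (hne u) := fun u => Nat.sInf_def (hne u)
  simp only [hfind]
  exact measurable_find hne fun m => measurableSet_mem_maximizers d p m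

theorem aemeasurable_apply_selection {Ω : Type*} [MeasurableSpace Ω] {P : Measure Ω}
    (hd : 1 ≤ d) {U : ℕ → Ω → ℝ} (hU : ∀ k, 1 ≤ k → k ≤ d → AEMeasurable (U k) P) (p : ℕ → ℝ) :
    AEMeasurable (fun ω => U (selection d (fun k => U k ω) p) ω) P := by
  set W : Ω → ℕ → ℝ := fun ω k => if 1 ≤ k ∧ k ≤ d then U k ω else 0 with hW
  have hWm : AEMeasurable W P := by
    refine aemeasurable_pi_iff.2 fun k => ?_
    by_cases hk : 1 ≤ k ∧ k ≤ d
    · simpa [hW, hk] using hU k hk.1 hk.2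
    · simp [hW, hk]
  have happly : Measurable fun u : ℕ → ℝ => u (selection d u p) :=
    (measurable_from_prod_countable_right fun k => measurable_pi_apply k :
      Measurable fun z : ℕ × (ℕ → ℝ) => z.2 z.1).comp
      ((measurable_selection hd p).prodMk measurable_id)
  refine (happly.comp_aemeasurable hWm).congr (ae_of_all _ fun ω => ?_)
  have hsel : selection d (W ω) p = selection d (fun k => U k ω) p := by
    rw [selection, selection, maximizers_congr fun k h1 h2 => if_pos ⟨h1, h2⟩]
  have hmem := (selection_isLeast hd (fun k => U k ω) p).1
  simp only [Function.comp_apply, hsel]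
  exact if_pos ⟨hmem.1, hmem.2.1⟩

theorem exists_le_sub_of_one_lt_selection (hS : 1 < selection d u p) :
    ∃ k ∈ Finset.Icc 2 d, p k - p 1 ≤ u k - u 1 := by
  have hmem : selection d u p ∈ maximizers d u p :=
    Nat.sInf_mem (Nat.nonempty_of_pos_sInf (zero_lt_one.trans hS))
  have hmax := hmem.2.2 1 le_rfl (hS.le.trans hmem.2.1)
  exact ⟨_, Finset.mem_Icc.2 ⟨hS, hmem.2.1⟩, by linarith⟩

variable {Ω : Type*} [MeasurableSpace Ω] {P : Measure Ω} {U : ℕ → ℕ → Ω → ℝ} {pen : ℕ → ℕ → ℝ}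

theorem tendsto_measure_one_lt_selection
    (hU : ∀ k, 2 ≤ k → k ≤ d →
      Tendsto (fun n => P {ω | pen k n - pen 1 n ≤ U k n ω - U 1 n ω}) atTop (𝓝 0)) :
    Tendsto (fun n => P {ω | 1 < selection d (fun k => U k n ω) fun k => pen k n})
      atTop (𝓝 0) := by
  have hsum : Tendsto (fun n => ∑ k ∈ Finset.Icc 2 d,
      P {ω | pen k n - pen 1 n ≤ U k n ω - U 1 n ω}) atTop (𝓝 0) := by
    rw [← Finset.sum_const_zero (s := Finset.Icc 2 d)]
    exact tendsto_finsetSum _ fun k hk => hU k (Finset.mem_Icc.1 hk).1 (Finset.mem_Icc.1 hk).2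
  refine tendsto_of_tendsto_of_tendsto_of_le_of_le tendsto_const_nhds hsum (fun _ => zero_le)
    fun n => (measure_mono fun ω hω => ?_).trans (measure_biUnion_finset_le _ _)
  simpa only [Set.mem_iUnion, Set.mem_ofPred_eq, exists_prop] using
    exists_le_sub_of_one_lt_selection hω

theorem tendstoInDistribution_apply_selection {Ω' : Type*} [MeasurableSpace Ω'] {P' : Measure Ω'}
    [IsProbabilityMeasure P] [IsProbabilityMeasure P'] {Z : Ω' → ℝ} (hd : 1 ≤ d)
    (hU : ∀ k, 1 ≤ k → k ≤ d → ∀ n, AEMeasurable (U k n) P)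
    (hS : Tendsto (fun n => P {ω | 1 < selection d (fun k => U k n ω) fun k => pen k n})
      atTop (𝓝 0))
    (hU1 : TendstoInDistribution (U 1) atTop Z (fun _ => P) P') :
    TendstoInDistribution
      (fun n ω => U (selection d (fun k => U k n ω) fun k => pen k n) n ω) atTop Z
      (fun _ => P) P' := by
  refine tendstoInDistribution_of_tendstoInMeasure_sub _ _ hU1 (fun δ hδ => ?_) fun n =>
    aemeasurable_apply_selection hd (U := fun k => U k n) (fun k h1 h2 => hU k h1 h2 n) _
  refine tendsto_of_tendsto_of_tendsto_of_le_of_le tendsto_const_nhds hS (fun _ => zero_le)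
    fun n => measure_mono fun ω hω => (lt_of_not_ge fun hle => ?_ : 1 < selection d _ _)
  have hone : selection d (fun k => U k n ω) (fun k => pen k n) = 1 :=
    le_antisymm hle (selection_isLeast hd _ _).1.1
  simp only [Set.mem_ofPred_eq, Pi.sub_apply, hone, sub_self, Pi.zero_apply, edist_self] at hω
  exact hδ.not_ge hω

end Selection

section NullModel

variable {Ω : Type*} [MeasurableSpace Ω] {P : Measure Ω} {f₀ h : ℝ → ℝ} {X ε : ℕ → Ω → ℝ}

theorem IsNullModel.iIndepFun_add (hnull : IsNullModel P f₀ h X ε) :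
    iIndepFun (fun i ω => X i ω + ε i ω) P :=
  hnull.indep_pairs.comp (fun _ z => z.1 + z.2) fun _ => by fun_prop

theorem IsNullModel.hasLaw_add (hnull : IsNullModel P f₀ h X ε) (hf₀ : IsDensity f₀)
    (hh : IsDensity h) {k : ℕ} {f : EuclideanSpace ℝ (Fin k) → ℝ → ℝ} (hf : f 0 =ᵐ[volume] f₀)
    (i : ℕ) : HasLaw (fun ω => X i ω + ε i ω) (obsLaw f h 0) P := by
  have := hf₀.isProbabilityMeasure_law
  have := hh.isProbabilityMeasure_law
  have hadd := (hnull.indep_signal_noise i).hasLaw_fun_add (hnull.law_signal i) (hnull.law_noise i)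
  have hobs : obsDensity f h 0 = fun y => ∫ s, f₀ s * h (y - s) := by
    funext y
    exact integral_congr_ae (hf.mono fun s hs => by simp only [hs])
  rwa [hf₀.law_conv_law hh, ← hobs] at hadd

end NullModel

end ScoreDeconvolution

open ScoreDeconvolution in
theorem mainTheorem5_general {Ω : Type*} [MeasurableSpace Ω] (P : Measure Ω)
    [IsProbabilityMeasure P] (f₀ h : ℝ → ℝ) (hf₀ : IsDensity f₀) (hh : IsDensity h)
    (d : ℕ) (hd : 1 ≤ d) (Θ : (k : ℕ) → Set (EuclideanSpace ℝ (Fin k)))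
    (f : (k : ℕ) → EuclideanSpace ℝ (Fin k) → ℝ → ℝ)
    (hΘ_open : ∀ k, 1 ≤ k → k ≤ d → IsOpen (Θ k))
    (hΘ_zero : ∀ k, 1 ≤ k → k ≤ d → (0 : EuclideanSpace ℝ (Fin k)) ∈ Θ k)
    (hf : ∀ k, 1 ≤ k → k ≤ d → ∀ θ ∈ Θ k, IsDensity (f k θ))
    (hf_zero : ∀ k, 1 ≤ k → k ≤ d → f k 0 =ᵐ[volume] f₀)
    (hreg : ∀ k, 1 ≤ k → k ≤ d → IsRegular (f k) h (Θ k))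
    (pen : ℕ → ℕ → ℝ)
    (hpen : ∀ k, 2 ≤ k → k ≤ d → Tendsto (fun n => pen k n - pen 1 n) atTop atTop)
    (X ε : ℕ → Ω → ℝ) (hnull : IsNullModel P f₀ h X ε) :
    Tendsto (fun n => P {ω | 1 < selectionRule f h d pen n (fun i => X i ω + ε i ω)}) atTop (𝓝 0) ∧
    TendstoInDistribution (fun n ω => dataDrivenStatistic f h d pen n (fun i => X i ω + ε i ω))
      atTop id (fun _ => P) (chiSquare 1) := by
  have hind := hnull.iIndepFun_add
  have hY := fun k h1 h2 => hnull.hasLaw_add hf₀ hh (hf_zero k h1 h2)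
  have hs := fun k h1 h2 => (hreg k h1 h2).memLp_score 0 (hΘ_zero k h1 h2)
  have hdet := fun k h1 h2 => (hreg k h1 h2).nonsingular 0 (hΘ_zero k h1 h2)
  have hs0 := fun k h1 h2 => (hreg k h1 h2).integral_score_eq_zero (hΘ_open k h1 h2)
    (hf k h1 h2) hh (hΘ_zero k h1 h2)
  set U : ℕ → ℕ → Ω → ℝ := fun k n ω => scoreStatistic (f k) h n fun i => X i ω + ε i ω
  have hU1 : ∀ n ω, 0 ≤ U 1 n ω := fun n ω =>
    scoreStatistic_nonneg (posDef_fisherInformation (hs 1 le_rfl hd) (hdet 1 le_rfl hd)) n _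
  have hS : Tendsto (fun n => P {ω | 1 < selection d (fun k => U k n ω) fun k => pen k n})
      atTop (𝓝 0) := tendsto_measure_one_lt_selection fun k h2 hkd => by
    have h1 : 1 ≤ k := one_le_two.trans h2
    exact tendsto_of_tendsto_of_tendsto_of_le_of_le tendsto_const_nhds
      (tendsto_measure_le_scoreStatistic (hY k h1 hkd) hind (hs k h1 hkd) (hs0 k h1 hkd)
        (hdet k h1 hkd) (hpen k h2 hkd))
      (fun _ => zero_le) fun n => measure_mono fun ω hω => hω.trans (sub_le_self _ (hU1 n ω))
  exact ⟨hS, tendstoInDistribution_apply_selection hd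
    (fun k h1 h2 n => (integrable_scoreStatistic (hY k h1 h2) (hs k h1 h2) n).aemeasurable) hS
    (tendstoInDistribution_scoreStatistic_fin_one (hY 1 le_rfl hd) hind (hs 1 le_rfl hd)
      (hs0 1 le_rfl hd 0) (hdet 1 le_rfl hd))⟩

theorem mainTheorem5 {Ω : Type*} [MeasurableSpace Ω] (P : Measure Ω) [IsProbabilityMeasure P]
    (f₀ h : ℝ → ℝ) (hf₀ : ScoreDeconvolution.IsDensity f₀)
    (hh : ScoreDeconvolution.IsNoiseDensity h)
    (d : ℕ) (hd : 1 ≤ d)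
    (Θ : (k : ℕ) → Set (EuclideanSpace ℝ (Fin k)))
    (f : (k : ℕ) → EuclideanSpace ℝ (Fin k) → ℝ → ℝ)
    (hΘ_open : ∀ k, 1 ≤ k → k ≤ d → IsOpen (Θ k))
    (hΘ_zero : ∀ k, 1 ≤ k → k ≤ d → (0 : EuclideanSpace ℝ (Fin k)) ∈ Θ k)
    (hf : ∀ k, 1 ≤ k → k ≤ d → ∀ θ ∈ Θ k, ScoreDeconvolution.IsDensity (f k θ))
    (hf_zero : ∀ k, 1 ≤ k → k ≤ d → f k 0 =ᵐ[volume] f₀)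
    (hreg : ∀ k, 1 ≤ k → k ≤ d → ScoreDeconvolution.IsRegular (f k) h (Θ k))
    (pen : ℕ → ℕ → ℝ) (hpen : ScoreDeconvolution.IsPenalty d pen)
    (X ε : ℕ → Ω → ℝ) (hnull : ScoreDeconvolution.IsNullModel P f₀ h X ε) :
    Tendsto (fun n => P {ω | 1 < ScoreDeconvolution.selectionRule f h d pen n
        (fun i => X i ω + ε i ω)}) atTop (𝓝 0) ∧
    TendstoInDistribution (fun n ω => ScoreDeconvolution.dataDrivenStatistic f h d pen n
        (fun i => X i ω + ε i ω)) atTop id (fun _ => P) (ScoreDeconvolution.chiSquare 1) :=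
  mainTheorem5_general P f₀ h hf₀ hh.toIsDensity d hd Θ f hΘ_open hΘ_zero hf hf_zero hreg pen
    hpen.tendsto_atTop X ε hnull
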